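/- Let $p$ be a prime and let $h\in\mathbb{Z}[t]$ be monic and irreducible modulo $p$. Put $R=\mathbb{Z}[t]/(h)$ and, for $e\ge 1$, let $R_e=R/(p^e)$ (the Galois ring of characteristic $p^e$ and extension degree $\deg h$, with residue field $R_1$), with canonical homomorphism $\pi_e:R\to R_e$, extended coefficientwise to polynomials. For polynomials $f,m\in R[x]$ let $\Gamma_e(f,m)$ be the map $z\mapsto \pi_e(f)z$ on $R_e[x]/(\pi_e(m))$. For a self-map $\Gamma$ of a finite set $X$ and $y\in X$, let $\tau\ge 0$ be the least integer such that $\Gamma^{\tau+\ell}(y)=\Gamma^{\tau}(y)$ for some $\ell>0$, let $\mathrm{per}(\Gamma,y)$ be the least such $\ell>0$ for this $\tau$, and let $\mathcal{C}(\Gamma)=\{\mathrm{per}(\Gamma,y): y\in X\}$ be the set of cycle lengths of $\Gamma$. For sets $A,B$ of positive integers let $A\odot B=\{\mathrm{lcm}(a,b): a\in A,\ b\in B\}$, and write $\bigodot$ for iterated products, the empty product being $\{1\}$. Theorem. Let $f,m\in R[x]$ with $m$ monic and $1\le \deg f<\deg m$, and let $e>1$. Let $m_1,m_2\in R_e[x]$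 satisfy $\pi_e(m)=m_1m_2$, where $\pi_e(f)$ and $m_1$ generate the unit ideal of $R_e[x]$ and some power of $\pi_e(f)$ is divisible by $m_2$. Let $m_1=g_1\cdots g_r$ with $g_1,\dots,g_r\in R_e[x]$ pairwise coprime (any two of them generate the unit ideal), such that for each $i$ the reduction of $g_i$ modulo $p$ equals $G_i^{k_i}$ for some irreducible $G_i\in R_1[x]$ and some integer $k_i\ge 0$. Let $\mathcal{O}_e(f,g_i)$ be the least integer $k>0$ such that $\pi_e(f)^k\equiv 1 \pmod{g_i}$ in $R_e[x]$. Then $$\mathcal{C}(\Gamma_e(f,m))=\mathcal{C}(\Gamma_{e-1}(f,m))\ \cup\ \bigodot_{i=1}^{r}\{1,\mathcal{O}_e(f,g_i)\}.$$ -/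

import Mathlib

open Polynomial

/-! ### Galois rings -/

/-- The ring `R = ℤ[t] / (h)`. -/
abbrev BaseRing (h : ℤ[X]) : Type := AdjoinRoot h

/-- The Galois ring `R_e = R / (p ^ e)`; for `h` monic and irreducible modulo the prime `p`, it has
characteristic `p ^ e` and extension degree `deg h`, and `R_1` is the residue field. -/
abbrev GaloisRing (h : ℤ[X]) (p e : ℕ) : Type :=
  BaseRing h ⧸ Ideal.span {((p : BaseRing h) ^ e)}

/-- The canonical homomorphism `π_e : R → R_e`. -/
noncomputable def canonicalHom (h : ℤ[X]) (p e : ℕ) : BaseRing h →+* GaloisRing h p e :=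
  Ideal.Quotient.mk _

/-- The reduction `R_e → R_e'` for `e' ≤ e`; the case `e' = 1` is the reduction to the residue
field. -/
noncomputable def reduction (h : ℤ[X]) (p : ℕ) {e' e : ℕ} (hle : e' ≤ e) :
    GaloisRing h p e →+* GaloisRing h p e' :=
  Ideal.Quotient.factor
    (Ideal.span_singleton_le_span_singleton.mpr (pow_dvd_pow (p : BaseRing h) hle))

/-! ### Finite dynamical systems -/

/-- The transient length of `x` under `Γ`: the least `τ ≥ 0` such that
`Γ^(τ+ℓ) x = Γ^τ x` for some `ℓ > 0`. -/
noncomputable def preperiod {α : Type*} (Γ : α → α) (x : α) : ℕ :=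
  sInf {τ : ℕ | ∃ ℓ : ℕ, 0 < ℓ ∧ Γ^[τ + ℓ] x = Γ^[τ] x}

/-- The cycle length of `x` under `Γ`: the least `ℓ > 0` such that `Γ^(τ+ℓ) x = Γ^τ x`,
where `τ` is the transient length of `x`. -/
noncomputable def period {α : Type*} (Γ : α → α) (x : α) : ℕ :=
  sInf {ℓ : ℕ | 0 < ℓ ∧ Γ^[preperiod Γ x + ℓ] x = Γ^[preperiod Γ x] x}

/-- The set of cycle lengths of a dynamical system. -/
def cycleLengths {α : Type*} (Γ : α → α) : Set ℕ := Set.range (period Γ)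

/-- The multiplication-by-`f` map on `S ⧸ I`. -/
def mulMap {S : Type*} [CommRing S] (f : S) (I : Ideal S) : S ⧸ I → S ⧸ I :=
  fun z => Ideal.Quotient.mk I f * z

/-- The system `Γ_e(f, m)`: multiplication by `f` on `R_e[x] / (m)`, for `f, m ∈ R[x]`. -/
noncomputable def galoisSystem (h : ℤ[X]) (p e : ℕ) (f m : (BaseRing h)[X]) :
    (GaloisRing h p e)[X] ⧸ Ideal.span {m.map (canonicalHom h p e)} →
      (GaloisRing h p e)[X] ⧸ Ideal.span {m.map (canonicalHom h p e)} :=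
  mulMap (f.map (canonicalHom h p e)) (Ideal.span {m.map (canonicalHom h p e)})

/-! ### Order of polynomials and `f`-decompositions -/

/-- The least `k > 0` such that `f ^ k ≡ 1` modulo `g`. -/
noncomputable def polyOrder {S : Type*} [CommRing S] (f g : S[X]) : ℕ :=
  sInf {k : ℕ | 0 < k ∧ g ∣ f ^ k - 1}

/-- `m = m₁ m₂` is an `f`-decomposition: `f` is coprime to `m₁` and lies in the radical
of the ideal generated by `m₂`. -/
structure IsFDecomposition {S : Type*} [CommRing S] (f m m₁ m₂ : S) : Prop where
  eq_mul : m = m₁ * m₂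
  coprime : IsCoprime f m₁
  mem_radical : f ∈ (Ideal.span {m₂}).radical

/-! ### The lcm-product -/

/-- The lcm-product of two sets of natural numbers. -/
def lcmProduct (A B : Set ℕ) : Set ℕ := {n | ∃ a ∈ A, ∃ b ∈ B, n = Nat.lcm a b}

/-- The lcm-product of a finite family of sets; the empty product is `{1}`,
the neutral element of the lcm-product. -/
def bigLcmProduct {r : ℕ} (A : Fin r → Set ℕ) : Set ℕ := (List.ofFn A).foldr lcmProduct {1}

theorem mem_bigLcmProduct {r : ℕ} (A : Fin r → Set ℕ) (n : ℕ) :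
    n ∈ bigLcmProduct A ↔ ∃ c : Fin r → ℕ, (∀ i, c i ∈ A i) ∧ n = Finset.univ.lcm c := by
  induction r generalizing n with
  | zero => simp [bigLcmProduct]
  | succ r ih =>
    have key : bigLcmProduct A = lcmProduct (A 0) (bigLcmProduct fun i => A i.succ) := by
      simp [bigLcmProduct, List.ofFn_succ]
    rw [key]
    constructor
    · rintro ⟨a, ha, b, hb, rfl⟩
      obtain ⟨c, hc, rfl⟩ := (ih _ _).1 hb
      refine ⟨Fin.cons a c, fun i => Fin.cases (by simpa using ha) (by simpa using hc) i, ?_⟩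
      rw [Fin.univ_succ, Finset.cons_eq_insert, Finset.lcm_insert, Finset.map_eq_image, Finset.lcm_image]
      rfl
    · rintro ⟨c, hc, rfl⟩
      refine ⟨c 0, hc 0, _, (ih _ _).2 ⟨fun i => c i.succ, fun i => hc _, rfl⟩, ?_⟩
      rw [Fin.univ_succ, Finset.cons_eq_insert, Finset.lcm_insert, Finset.map_eq_image, Finset.lcm_image]
      rfl

/-! The factor `m₂` affects only transients: the period of `z` divides `l` iff `f ^ N * (f ^ l - 1)
* z` vanishes mod `m` for some `N`, and this holds iff every `g i` divides `(f ^ l - 1) * z`. By the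
Chinese remainder theorem, cycle lengths are then exactly the lcms of independently chosen periods
of multiplication by `f` on the quotients by the `g i` (`cycleLengths_mulMap`).

In each such quotient every element is nilpotent or a unit, and `p` is nilpotent. If the image of
`f` has order `d * p ^ J` with `d` its order modulo nilpotents, the periods are exactly `1` and the
`d * p ^ j` with `j ≤ J` (`range_minimalPeriod_mul`). Passing from `e - 1` to `e` keeps `d` and
raises `J` by at most one (`orderOf_mk_dvd_mul`, `coprime_mul_pow_sandwich`). The rest is arithmetic
of lcms: a length is either attainable with the old exponents or an lcm of full orders
(`exists_lcm_mul_pow_iff`). -/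

/-! ### Periods and the Chinese remainder theorem -/

theorem period_dvd_iff {α : Type*} [Finite α] (Γ : α → α) (x : α) (l : ℕ) :
    period Γ x ∣ l ↔ ∃ N, Γ^[N + l] x = Γ^[N] x := by
  have hne : {τ : ℕ | ∃ ℓ : ℕ, 0 < ℓ ∧ Γ^[τ + ℓ] x = Γ^[τ] x}.Nonempty := by
    obtain ⟨a, b, hab, h⟩ := Finite.exists_ne_map_eq_of_infinite fun n : ℕ => Γ^[n] x
    rcases lt_or_gt_of_ne hab with hlt | hlt
    · exact ⟨a, b - a, by omega, by simpa [Nat.add_sub_cancel' hlt.le] using h.symm⟩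
    · exact ⟨b, a - b, by omega, by simpa [Nat.add_sub_cancel' hlt.le] using h⟩
  set τ := preperiod Γ x with hτ
  obtain ⟨P, hP, hPx⟩ : ∃ ℓ : ℕ, 0 < ℓ ∧ Γ^[τ + ℓ] x = Γ^[τ] x := Nat.sInf_mem hne
  have key : ∀ n, Γ^[τ + n] x = Γ^[n] (Γ^[τ] x) := fun n => by
    rw [add_comm, Function.iterate_add_apply]
  have hper : ∀ n, Function.IsPeriodicPt Γ n (Γ^[τ] x) ↔ Γ^[τ + n] x = Γ^[τ] x := fun n => by
    rw [key]; rfl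
  have hPp := (hper P).2 hPx
  have hmin : period Γ x = Function.minimalPeriod Γ (Γ^[τ] x) := by
    apply le_antisymm
    · exact Nat.sInf_le ⟨hPp.minimalPeriod_pos hP,
        (hper _).1 (Function.isPeriodicPt_minimalPeriod _ _)⟩
    · obtain ⟨h0, h1⟩ := Nat.sInf_mem (s := {ℓ : ℕ | 0 < ℓ ∧ Γ^[τ + ℓ] x = Γ^[τ] x}) ⟨P, hP, hPx⟩
      exact Function.IsPeriodicPt.minimalPeriod_le h0 ((hper _).2 h1)
  rw [hmin, ← Function.isPeriodicPt_iff_minimalPeriod_dvd, hper]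
  refine ⟨fun h => ⟨τ, h⟩, fun ⟨N, hN⟩ => ?_⟩
  have h1 : ∀ n, N ≤ n → Γ^[n + l] x = Γ^[n] x := fun n hn => by
    obtain ⟨a, rfl⟩ := Nat.exists_eq_add_of_le hn
    rw [show N + a + l = a + (N + l) by ring, Function.iterate_add_apply, hN,
      ← Function.iterate_add_apply, add_comm]
  have h2 : Γ^[P * N] (Γ^[τ] x) = Γ^[τ] x := hPp.mul_const N
  -- `N` may lie beyond `τ`; going round the cycle `N` times returns to the same point at an index
  -- at least `N`.
  have h3 := h1 (τ + P * N) (by nlinarith)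
  rw [key (P * N), h2, add_assoc, key, add_comm (P * N), Function.iterate_add_apply, h2] at h3
  rw [key, h3]

theorem minimalPeriod_mul_dvd_iff {A : Type*} [CommRing A] (u z : A) (l : ℕ) :
    Function.minimalPeriod (u * ·) z ∣ l ↔ (u ^ l - 1) * z = 0 := by
  rw [← Function.isPeriodicPt_iff_minimalPeriod_dvd, Function.IsPeriodicPt,
    Function.IsFixedPt, mul_left_iterate, sub_mul, one_mul, sub_eq_zero]

theorem cycleLengths_mulMap {S : Type*} [CommRing S] {f m m₁ m₂ : S}
    (hd : IsFDecomposition f m m₁ m₂) [Finite (S ⧸ Ideal.span {m})]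
    {r : ℕ} {g : Fin r → S} (hprod : m₁ = ∏ i, g i)
    (hcop : Pairwise fun i j => IsCoprime (g i) (g j)) (n : ℕ) :
    n ∈ cycleLengths (mulMap f (Ideal.span {m})) ↔
      ∃ c : Fin r → ℕ, (∀ i, c i ∈ Set.range
        (Function.minimalPeriod (Ideal.Quotient.mk (Ideal.span {g i}) f * ·))) ∧
        n = Finset.univ.lcm c := by
  have key : ∀ (Z : S) (l : ℕ),
      period (mulMap f (Ideal.span {m})) (Ideal.Quotient.mk _ Z) ∣ l ↔
        Finset.univ.lcm (fun i => Function.minimalPeriod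
          (Ideal.Quotient.mk (Ideal.span {g i}) f * ·) (Ideal.Quotient.mk _ Z)) ∣ l := by
    intro Z l
    have hit : ∀ N, (mulMap f (Ideal.span {m}))^[N] (Ideal.Quotient.mk _ Z) =
        Ideal.Quotient.mk _ (f ^ N * Z) := fun N => by
      rw [show mulMap f (Ideal.span {m}) = (Ideal.Quotient.mk _ f * ·) from rfl,
        mul_left_iterate, map_mul, map_pow]
    have hR : Finset.univ.lcm (fun i => Function.minimalPeriod
        (Ideal.Quotient.mk (Ideal.span {g i}) f * ·) (Ideal.Quotient.mk _ Z)) ∣ l ↔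
        ∀ i, g i ∣ (f ^ l - 1) * Z := by
      simp only [Finset.lcm_dvd_iff, Finset.mem_univ, true_imp_iff, minimalPeriod_mul_dvd_iff,
        ← map_pow, ← map_mul, ← map_one (Ideal.Quotient.mk _), ← map_sub,
        Ideal.Quotient.eq_zero_iff_dvd]
    rw [period_dvd_iff, hR]
    simp only [hit, Ideal.Quotient.mk_eq_mk_iff_sub_mem, Ideal.mem_span_singleton]
    have e : ∀ N, f ^ (N + l) * Z - f ^ N * Z = f ^ N * ((f ^ l - 1) * Z) := fun N => by ring
    simp only [e]
    constructor
    · rintro ⟨N, hN⟩ i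
      have h1 : g i ∣ m₁ := hprod ▸ Finset.dvd_prod_of_mem _ (Finset.mem_univ i)
      have h2 : g i ∣ f ^ N * ((f ^ l - 1) * Z) :=
        (h1.trans (hd.eq_mul ▸ dvd_mul_right _ _)).trans hN
      exact ((hd.coprime.of_isCoprime_of_dvd_right h1).symm.pow_right).dvd_of_dvd_mul_left h2
    · intro h
      obtain ⟨N, hN⟩ := hd.mem_radical
      refine ⟨N, ?_⟩
      rw [hd.eq_mul, mul_comm]
      refine mul_dvd_mul (Ideal.mem_span_singleton.1 hN) ?_
      rw [hprod]
      exact Fintype.prod_dvd_of_coprime hcop h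
  constructor
  · rintro ⟨z, rfl⟩
    obtain ⟨Z, rfl⟩ := Ideal.Quotient.mk_surjective z
    -- A natural number is determined by its set of multiples.
    exact ⟨_, fun i => ⟨_, rfl⟩, Nat.dvd_left_injective (funext fun l => propext (key Z l))⟩
  · rintro ⟨c, hc, rfl⟩
    choose z hz using hc
    have hI : Pairwise fun i j => IsCoprime (Ideal.span {g i}) (Ideal.span {g j}) :=
      fun i j hij => (Ideal.isCoprime_span_singleton_iff _ _).2 (hcop hij)
    obtain ⟨W, hW⟩ := Ideal.pi_quotient_surjective hI z
    refine ⟨Ideal.Quotient.mk _ W, ?_⟩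
    have := Nat.dvd_left_injective (funext fun l => propext (key W l))
    rw [this]
    congr 1
    funext i
    rw [← hz i, ← hW i]

/-! ### Periods of a unit in a local ring with nil maximal ideal -/

theorem IsNilpotent.exists_pow_mul_ne_zero {A : Type*} [CommRing A] {x y : A}
    (hx : IsNilpotent x) (hy : y ≠ 0) : ∃ n, x ^ n * y ≠ 0 ∧ x * (x ^ n * y) = 0 := by
  classical
  have hex : ∃ n, x ^ n * y = 0 := by
    obtain ⟨n, hn⟩ := hx
    exact ⟨n, by rw [hn, zero_mul]⟩
  have h0 : Nat.find hex ≠ 0 := fun h => hy (by simpa [h] using Nat.find_spec hex)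
  obtain ⟨n, hn⟩ := Nat.exists_eq_succ_of_ne_zero h0
  refine ⟨n, Nat.find_min hex (by omega), ?_⟩
  rw [← mul_assoc, ← pow_succ', ← Nat.succ_eq_add_one, ← hn]
  exact Nat.find_spec hex

/-- Since `N ^ 2` kills `z`, the binomial expansion on `z` stops at the linear term. -/
theorem one_add_pow_sub_one_mul_eq_zero {A : Type*} [CommRing A] {N z : A} (n : ℕ)
    (h1 : (n : A) * (N * z) = 0) (h2 : N * (N * z) = 0) : ((1 + N) ^ n - 1) * z = 0 := by
  have key : ∀ k : ℕ, ((1 + N) ^ k - 1) * z = k * (N * z) := by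
    intro k
    induction k with
    | zero => simp
    | succ k ih =>
      have : ((1 + N) ^ (k + 1) - 1) * z =
          ((1 + N) ^ k - 1) * z + N * (((1 + N) ^ k - 1) * z) + N * z := by ring
      rw [this, ih]
      push_cast
      linear_combination (k : A) * h2
  rw [key, h1]

/-- One `p`-power exponent kills `N` modulo `p`; after that each further `p`-th power gains a factor
`p`, which is nilpotent. -/
theorem exists_one_add_pow_prime_pow_eq_one {A : Type*} [CommRing A] {p : ℕ} (hp : p.Prime)
    (hpA : IsNilpotent (p : A)) {N : A} (hN : IsNilpotent N) : ∃ j, (1 + N) ^ p ^ j = 1 := by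
  obtain ⟨a, ha⟩ := hN
  obtain ⟨b, hb⟩ := hpA
  obtain ⟨w, hw⟩ := exists_add_pow_prime_pow_eq hp 1 N a
  have hNa : N ^ p ^ a = 0 := pow_eq_zero_of_le (Nat.lt_pow_self hp.one_lt).le ha
  have hdvd : (p : A) ∣ (1 + N) ^ p ^ a - 1 := ⟨N * w, by rw [hw, hNa]; ring⟩
  have h := dvd_sub_pow_of_dvd_sub hdvd b
  rw [pow_succ, hb, zero_mul, zero_dvd_iff, one_pow, sub_eq_zero, ← pow_mul, ← pow_add] at h
  exact ⟨_, h⟩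

/-- If `z ≠ 0`, then `u ^ l * z = z` makes `u ^ l - 1` a non-unit, hence nilpotent, so `d` divides
`l`. Conversely, each `d * p ^ j` is realised by multiplying a nonzero element by nilpotents until
just before it vanishes. -/
theorem range_minimalPeriod_mul {A : Type*} [CommRing A] {p : ℕ} (hp : p.Prime)
    (hpA : IsNilpotent (p : A)) (hA : ∀ a : A, IsNilpotent a ∨ IsUnit a) {u : A}
    (hu : IsOfFinOrder u) :
    ∃ d J : ℕ, p.Coprime d ∧ orderOf u = d * p ^ J ∧
      ∀ k, k ∈ Set.range (Function.minimalPeriod (u * ·)) ↔ k = 1 ∨ ∃ j ≤ J, k = d * p ^ j := by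
  -- The zero ring does occur, when `g i` reduces to `G i ^ 0`.
  rcases subsingleton_or_nontrivial A with hs | hn
  · refine ⟨1, 0, by simp, by simp [Subsingleton.elim u 1], fun k => ?_⟩
    simp [Function.minimalPeriod_eq_one_of_subsingleton, eq_comm]
  set q := Ideal.Quotient.mk (nilradical A) with hq
  have hqn : ∀ a, q a = 0 ↔ IsNilpotent a := fun a => by
    rw [hq, Ideal.Quotient.eq_zero_iff_mem, mem_nilradical]
  have hdq : ∀ l, orderOf (q u) ∣ l ↔ IsNilpotent (u ^ l - 1) := fun l => by
    rw [orderOf_dvd_iff_pow_eq_one, ← hqn, map_sub, map_pow, map_one, sub_eq_zero]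
  set d := orderOf (q u) with hd
  have hdu : d ∣ orderOf u := orderOf_map_dvd q.toMonoidHom u
  have hd0 : 0 < d := Nat.pos_of_dvd_of_pos hdu hu.orderOf_pos
  have hcop : p.Coprime d := by
    rw [hp.coprime_iff_not_dvd]
    rintro ⟨d', hd'⟩
    -- Frobenius: modulo `p` this power is `u ^ (p * d') - 1 = u ^ d - 1`.
    have h1 : IsNilpotent ((u ^ d' - 1) ^ p) := by
      obtain ⟨w, hw⟩ := exists_add_pow_prime_eq hp (u ^ d' - 1) 1
      have h2 : (u ^ d' - 1) ^ p = (u ^ d - 1) + (p : A) * (-((u ^ d' - 1) * w)) := by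
        rw [hd', mul_comm p, pow_mul]
        rw [sub_add_cancel] at hw
        rw [hw]; ring
      rw [h2]
      exact (Commute.all _ _).isNilpotent_add ((hdq d).1 dvd_rfl)
        ((Commute.all _ _).isNilpotent_mul_right hpA)
    have h3 := (hdq d').2 (IsNilpotent.of_pow h1)
    have hd'0 : 0 < d' := Nat.pos_of_ne_zero (by rintro rfl; omega)
    have := Nat.le_of_dvd hd'0 h3
    nlinarith [hp.two_le]
  obtain ⟨J, hJ⟩ : ∃ J, orderOf u = d * p ^ J := by
    obtain ⟨j, hj⟩ := exists_one_add_pow_prime_pow_eq_one hp hpA ((hdq d).1 dvd_rfl)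
    rw [add_sub_cancel] at hj
    obtain ⟨c, hc⟩ := hdu
    have : d * c ∣ d * p ^ j := by
      rw [← hc, orderOf_dvd_iff_pow_eq_one, pow_mul, hj]
    obtain ⟨J, -, rfl⟩ := (Nat.dvd_prime_pow hp).1 (Nat.dvd_of_mul_dvd_mul_left hd0 this)
    exact ⟨J, hc⟩
  have hz : ∀ z : A, z ≠ 0 → d ∣ Function.minimalPeriod (u * ·) z := fun z hz => by
    rw [hdq]
    refine (hA _).resolve_right fun h => hz ?_
    exact (h.mul_right_eq_zero).1 ((minimalPeriod_mul_dvd_iff u z _).1 dvd_rfl)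
  have hzj : ∀ (z : A) (j : ℕ), z ≠ 0 → Function.minimalPeriod (u * ·) z ∣ d * p ^ j →
      ∃ i ≤ j, Function.minimalPeriod (u * ·) z = d * p ^ i := fun z j h0 h => by
    obtain ⟨c, hc⟩ := hz z h0
    rw [hc] at h
    obtain ⟨i, hi, rfl⟩ := (Nat.dvd_prime_pow hp).1 (Nat.dvd_of_mul_dvd_mul_left hd0 h)
    exact ⟨i, hi, hc⟩
  refine ⟨d, J, hcop, hJ, fun k => ⟨?_, ?_⟩⟩
  · rintro ⟨z, rfl⟩
    by_cases h0 : z = 0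
    · left
      rw [Function.minimalPeriod_eq_one_iff_isFixedPt, h0]
      exact mul_zero u
    · exact Or.inr (hzj z J h0
        ((minimalPeriod_mul_dvd_iff u z _).2 (by rw [← hJ, pow_orderOf_eq_one]; simp)))
  · rintro (rfl | ⟨j, hj, rfl⟩)
    · exact ⟨0, Function.minimalPeriod_eq_one_iff_isFixedPt.2 (mul_zero u)⟩
    rcases j with _ | j
    · obtain ⟨n, hn0, hn1⟩ := ((hdq d).1 dvd_rfl).exists_pow_mul_ne_zero (one_ne_zero (α := A))
      refine ⟨(u ^ d - 1) ^ n * 1, ?_⟩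
      obtain ⟨i, hi, h⟩ := hzj _ 0 hn0 ((minimalPeriod_mul_dvd_iff u _ _).2 (by simpa using hn1))
      rw [h, Nat.le_zero.1 hi]
    · set N := u ^ (d * p ^ j) - 1 with hN
      have hNn : IsNilpotent N := (hdq _).1 (dvd_mul_right _ _)
      have hN0 : N ≠ 0 := fun h => by
        have := orderOf_dvd_of_pow_eq_one (sub_eq_zero.1 h)
        rw [hJ] at this
        have := (Nat.pow_dvd_pow_iff_le_right hp.one_lt).1 (Nat.dvd_of_mul_dvd_mul_left hd0 this)
        omega
      obtain ⟨a, ha0, ha1⟩ := hpA.exists_pow_mul_ne_zero hN0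
      obtain ⟨b, hb0, hb1⟩ := hNn.exists_pow_mul_ne_zero ha0
      -- Here `N * z ≠ 0`, while `p` and `N` both kill `N * z`: so `1 + N = u ^ (d * p ^ j)` moves
      -- `z` but its `p`-th power fixes it.
      set z := N ^ b * (p : A) ^ a with hzdef
      have e1 : N ^ b * ((p : A) ^ a * N) = N * z := by rw [hzdef]; ring
      rw [e1] at hb0 hb1
      have hz0 : z ≠ 0 := right_ne_zero_of_mul hb0
      have e2 : (p : A) * (N * z) = 0 := by
        rw [← e1, mul_left_comm, ha1, mul_zero]
      refine ⟨z, ?_⟩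
      obtain ⟨i, hi, h⟩ := hzj z (j + 1) hz0 ((minimalPeriod_mul_dvd_iff u _ _).2 (by
        have := one_add_pow_sub_one_mul_eq_zero p e2 hb1
        rwa [hN, add_sub_cancel, ← pow_mul, mul_assoc, ← pow_succ] at this))
      rw [h]
      rcases Nat.lt_or_ge i (j + 1) with hlt | hge
      · exact absurd ((minimalPeriod_mul_dvd_iff u z (d * p ^ j)).1
          (h ▸ mul_dvd_mul_left d (pow_dvd_pow p (Nat.lt_succ_iff.1 hlt)))) hb0
      · rw [le_antisymm hi hge]

/-! ### Arithmetic of lcms -/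

theorem coprime_mul_pow_sandwich {p d d' J J' : ℕ} (hp : p.Prime) (hd : p.Coprime d)
    (hd' : p.Coprime d') (h1 : d' * p ^ J' ∣ d * p ^ J) (h2 : d * p ^ J ∣ p * (d' * p ^ J')) :
    d' = d ∧ J' ≤ J ∧ J ≤ J' + 1 := by
  have h2' : d * p ^ J ∣ d' * p ^ (J' + 1) := by rwa [pow_succ, ← mul_assoc, mul_comm _ p]
  refine ⟨Nat.dvd_antisymm ?_ ?_, ?_, ?_⟩
  · exact (hd'.symm.pow_right J).dvd_of_dvd_mul_right ((dvd_mul_right _ _).trans h1)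
  · exact (hd.symm.pow_right _).dvd_of_dvd_mul_right ((dvd_mul_right _ _).trans h2')
  · exact (Nat.pow_dvd_pow_iff_le_right hp.one_lt).1
      ((hd.pow_left J').dvd_of_dvd_mul_left ((dvd_mul_left _ _).trans h1))
  · exact (Nat.pow_dvd_pow_iff_le_right hp.one_lt).1
      ((hd'.pow_left J).dvd_of_dvd_mul_left ((dvd_mul_left _ _).trans h2'))

/-- As `p` is coprime to every `d i`, only the largest exponent `j s` among the entries other than
`1` affects the lcm. Either one of these indices allows that exponent already under `J'`, or all of
them satisfy `J i ≤ j s`. -/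
theorem exists_lcm_mul_pow_iff {ι : Type*} [Fintype ι] {p : ℕ} {d J J' : ι → ℕ}
    (hd : ∀ i, p.Coprime (d i)) (h1 : ∀ i, J' i ≤ J i) (h2 : ∀ i, J i ≤ J' i + 1) (n : ℕ) :
    (∃ c : ι → ℕ, (∀ i, c i = 1 ∨ ∃ j ≤ J i, c i = d i * p ^ j) ∧ n = Finset.univ.lcm c) ↔
      (∃ c : ι → ℕ, (∀ i, c i = 1 ∨ ∃ j ≤ J' i, c i = d i * p ^ j) ∧ n = Finset.univ.lcm c) ∨
      ∃ c : ι → ℕ, (∀ i, c i = 1 ∨ c i = d i * p ^ J i) ∧ n = Finset.univ.lcm c := by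
  classical
  constructor
  swap
  · rintro (⟨c, hc, rfl⟩ | ⟨c, hc, rfl⟩)
    · exact ⟨c, fun i => (hc i).imp_right fun ⟨j, hj, h⟩ => ⟨j, hj.trans (h1 i), h⟩, rfl⟩
    · exact ⟨c, fun i => (hc i).imp_right fun h => ⟨J i, le_rfl, h⟩, rfl⟩
  rintro ⟨c, hc, rfl⟩
  choose! j hj hcj using fun (i : ι) (hi : c i ≠ 1) => (hc i).resolve_left hi
  rcases (Finset.univ.filter fun i => c i ≠ 1).eq_empty_or_nonempty with hS | hS
  · refine Or.inl ⟨c, fun i => Or.inl ?_, rfl⟩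
    by_contra h
    exact Finset.notMem_empty i (hS ▸ Finset.mem_filter.2 ⟨Finset.mem_univ i, h⟩)
  obtain ⟨s, hs, hmax⟩ := Finset.exists_max_image _ j hS
  have hs1 : c s ≠ 1 := (Finset.mem_filter.1 hs).2
  replace hmax : ∀ i, c i ≠ 1 → j i ≤ j s := fun i hi =>
    hmax i (Finset.mem_filter.2 ⟨Finset.mem_univ i, hi⟩)
  have hdvd : ∀ (c' : ι → ℕ) (t : ι), d t ∣ Finset.univ.lcm c' → p ^ j s ∣ Finset.univ.lcm c' →
      d t * p ^ j s ∣ Finset.univ.lcm c' := fun c' t h h' =>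
    ((hd t).symm.pow_right _).mul_dvd_of_dvd_of_dvd h h'
  have hd_c : ∀ i, c i ≠ 1 → d i ∣ Finset.univ.lcm c := fun i hi =>
    (Dvd.intro _ (hcj i hi).symm).trans (Finset.dvd_lcm (Finset.mem_univ i))
  have hp_c : p ^ j s ∣ Finset.univ.lcm c :=
    (Dvd.intro_left _ (hcj s hs1).symm).trans (Finset.dvd_lcm (Finset.mem_univ s))
  by_cases hex : ∃ t, c t ≠ 1 ∧ j s ≤ J' t
  · obtain ⟨t, ht, htJ⟩ := hex
    -- Index `t` carries the whole power of `p`; the others keep only `d i`.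
    refine Or.inl ⟨fun i => if i = t then d i * p ^ j s else if c i = 1 then 1 else d i,
      fun i => ?_, ?_⟩
    · dsimp only
      split_ifs with hit hi
      · exact Or.inr ⟨j s, hit ▸ htJ, rfl⟩
      · exact Or.inl rfl
      · exact Or.inr ⟨0, Nat.zero_le _, by simp⟩
    · set c' : ι → ℕ := fun i => if i = t then d i * p ^ j s else if c i = 1 then 1 else d i
        with hc'
      have ht' : d t * p ^ j s ∣ Finset.univ.lcm c' := by
        have := Finset.dvd_lcm (f := c') (Finset.mem_univ t)
        simpa [hc'] using this
      apply Nat.dvd_antisymm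
      · refine Finset.lcm_dvd fun i _ => ?_
        by_cases hi : c i = 1
        · rw [hi]; exact one_dvd _
        · have hdi : d i ∣ Finset.univ.lcm c' := by
            by_cases hit : i = t
            · rw [hit]; exact (dvd_mul_right _ _).trans ht'
            · have := Finset.dvd_lcm (f := c') (Finset.mem_univ i)
              simpa [hc', hit, hi] using this
          rw [hcj i hi]
          exact (mul_dvd_mul_left _ (pow_dvd_pow p (hmax i hi))).trans
            (hdvd c' i hdi ((dvd_mul_left _ _).trans ht'))
      · refine Finset.lcm_dvd fun i _ => ?_
        rw [hc']
        dsimp only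
        split_ifs with hit hi
        · rw [hit]; exact hdvd c t (hd_c t ht) hp_c
        · exact one_dvd _
        · exact hd_c i hi
  · push Not at hex
    have hJs : ∀ i, c i ≠ 1 → J i ≤ j s := fun i hi => by
      have := hex i hi
      have := h2 i
      omega
    -- Raising every exponent to `J i` is harmless, since `J i ≤ j s`.
    refine Or.inr ⟨fun i => if c i = 1 then 1 else d i * p ^ J i, fun i => ?_, ?_⟩
    · dsimp only
      split_ifs
      · exact Or.inl rfl
      · exact Or.inr rfl
    · apply Nat.dvd_antisymm
      · refine Finset.lcm_mono_fun fun i _ => ?_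
        split_ifs with hi
        · rw [hi]
        · exact hcj i hi ▸ mul_dvd_mul_left _ (pow_dvd_pow p (hj i hi))
      · refine Finset.lcm_dvd fun i _ => ?_
        split_ifs with hi
        · exact one_dvd _
        · exact (mul_dvd_mul_left _ (pow_dvd_pow p (hJs i hi))).trans (hdvd c i (hd_c i hi) hp_c)

/-! ### Local quotients and orders under reduction -/

/-- Divisibility of `a.map φ` by `G` decides: if it holds, `a ^ k` is a multiple of `g` up to a
nilpotent; otherwise a Bézout identity with `G ^ k` lifts up to a nilpotent. -/
theorem isNilpotent_or_isUnit_mk_of_map_eq_pow {A F : Type*} [CommRing A] [Field F] (φ : A →+* F)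
    (hφ : Function.Surjective φ) (hker : ∀ a, φ a = 0 → IsNilpotent a) {g : A[X]} {G : F[X]}
    {k : ℕ} (hG : Irreducible G) (hg : g.map φ = G ^ k) (a : A[X] ⧸ Ideal.span {g}) :
    IsNilpotent a ∨ IsUnit a := by
  have hnil : ∀ b : A[X], b.map φ = 0 → IsNilpotent b := fun b hb => by
    rw [Polynomial.isNilpotent_iff]
    intro i
    exact hker _ (by rw [← Polynomial.coeff_map, hb, coeff_zero])
  have hsurj := Polynomial.map_surjective φ hφ
  obtain ⟨a, rfl⟩ := Ideal.Quotient.mk_surjective a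
  have hg0 : Ideal.Quotient.mk (Ideal.span {g}) g = 0 :=
    Ideal.Quotient.eq_zero_iff_dvd _ _ |>.2 dvd_rfl
  by_cases h : G ∣ a.map φ
  · left
    obtain ⟨c, hc⟩ := h
    obtain ⟨c, rfl⟩ := hsurj c
    have h1 : IsNilpotent (a ^ k - g * c ^ k) := hnil _ (by
      rw [Polynomial.map_sub, Polynomial.map_pow, Polynomial.map_mul, Polynomial.map_pow, hg, hc,
        mul_pow, sub_self])
    have h2 := h1.map (Ideal.Quotient.mk (Ideal.span {g}))
    rw [map_sub, map_mul, hg0, zero_mul, sub_zero, map_pow] at h2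
    exact IsNilpotent.of_pow h2
  · right
    obtain ⟨s, t, hst⟩ := ((hG.coprime_iff_not_dvd.2 h).pow_left (m := k))
    obtain ⟨s, rfl⟩ := hsurj s
    obtain ⟨t, rfl⟩ := hsurj t
    have h1 : IsNilpotent (s * g + t * a - 1) := hnil _ (by
      rw [Polynomial.map_sub, Polynomial.map_add, Polynomial.map_mul, Polynomial.map_mul, hg, hst,
        Polynomial.map_one, sub_self])
    have h2 := (h1.map (Ideal.Quotient.mk (Ideal.span {g}))).isUnit_add_one
    rw [← map_one (Ideal.Quotient.mk (Ideal.span {g})), ← map_add, sub_add_cancel, map_add,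
      map_mul, hg0, mul_zero, zero_add, map_mul] at h2
    exact isUnit_of_mul_isUnit_right h2

theorem polyOrder_eq_orderOf {S : Type*} [CommRing S] (f g : S[X]) :
    polyOrder f g = orderOf (Ideal.Quotient.mk (Ideal.span {g}) f) := by
  have h : ∀ k, g ∣ f ^ k - 1 ↔ orderOf (Ideal.Quotient.mk (Ideal.span {g}) f) ∣ k := fun k => by
    rw [orderOf_dvd_iff_pow_eq_one, ← map_pow, ← sub_eq_zero,
      ← map_one (Ideal.Quotient.mk (Ideal.span {g})), ← map_sub, Ideal.Quotient.eq_zero_iff_dvd]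
  simp only [polyOrder, h]
  rcases Nat.eq_zero_or_pos (orderOf (Ideal.Quotient.mk (Ideal.span {g}) f)) with h0 | h0
  -- With no positive exponent, both sides take the default value `0`.
  · rw [h0, Nat.sInf_eq_zero]
    right
    ext k
    simp only [zero_dvd_iff, Set.mem_ofPred_eq, Set.mem_empty_iff_false, iff_false]
    omega
  · apply le_antisymm
    · exact Nat.sInf_le ⟨h0, dvd_rfl⟩
    · obtain ⟨h1, h2⟩ := Nat.sInf_mem (s := {k : ℕ | 0 < k ∧
        orderOf (Ideal.Quotient.mk (Ideal.span {g}) f) ∣ k}) ⟨_, h0, dvd_rfl⟩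
      exact Nat.le_of_dvd h1 h2

theorem isOfFinOrder_mk_of_dvd {S : Type*} [CommRing S] {f g m : S}
    [Finite (S ⧸ Ideal.span {m})] (hgm : g ∣ m) (hfg : IsCoprime f g) :
    IsOfFinOrder (Ideal.Quotient.mk (Ideal.span {g}) f) := by
  have : Finite (S ⧸ Ideal.span {g}) := Finite.of_surjective _
    (Ideal.Quotient.factor_surjective (Ideal.span_singleton_le_span_singleton.2 hgm))
  obtain ⟨s, t, hst⟩ := hfg
  have hu : IsUnit (Ideal.Quotient.mk (Ideal.span {g}) f) := by
    refine IsUnit.of_mul_eq_one (Ideal.Quotient.mk _ s) ?_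
    rw [← map_mul, ← map_one (Ideal.Quotient.mk _), Ideal.Quotient.mk_eq_mk_iff_sub_mem,
      Ideal.mem_span_singleton, ← hst]
    exact ⟨-t, by ring⟩
  obtain ⟨u, hu⟩ := hu
  rw [← hu, Units.isOfFinOrder_val]
  exact isOfFinOrder_of_finite u

theorem orderOf_mk_map_dvd {S T : Type*} [CommRing S] [CommRing T] (ρ : S →+* T) (f g : S) :
    orderOf (Ideal.Quotient.mk (Ideal.span {ρ g}) (ρ f)) ∣
      orderOf (Ideal.Quotient.mk (Ideal.span {g}) f) := by
  have h := pow_orderOf_eq_one (Ideal.Quotient.mk (Ideal.span {g}) f)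
  rw [orderOf_dvd_iff_pow_eq_one]
  rw [← map_pow, ← map_one (Ideal.Quotient.mk _), Ideal.Quotient.mk_eq_mk_iff_sub_mem,
    Ideal.mem_span_singleton] at h ⊢
  simpa using map_dvd ρ h

/-- If `f ^ n` is `1` at level `e - 1`, it is `1 + N` at level `e` with `N` a multiple of `p ^ (e -
1)`. Then `p * N = 0`, and `N ^ 2 = 0` because `2 * (e - 1) ≥ e`, so `(1 + N) ^ p = 1`. -/
theorem orderOf_mk_dvd_mul {S T : Type*} [CommRing S] [CommRing T] {ρ : S →+* T}
    (hρ : Function.Surjective ρ) {p e : ℕ} (he : 1 < e) (hpS : (p : S) ^ e = 0)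
    (hker : ∀ a, ρ a = 0 → (p : S) ^ (e - 1) ∣ a) (f g : S) :
    orderOf (Ideal.Quotient.mk (Ideal.span {g}) f) ∣
      p * orderOf (Ideal.Quotient.mk (Ideal.span {ρ g}) (ρ f)) := by
  set n := orderOf (Ideal.Quotient.mk (Ideal.span {ρ g}) (ρ f)) with hn
  have h : Ideal.Quotient.mk (Ideal.span {ρ g}) (ρ f) ^ n = 1 := pow_orderOf_eq_one _
  rw [← map_pow, ← map_one (Ideal.Quotient.mk _), Ideal.Quotient.mk_eq_mk_iff_sub_mem,
    Ideal.mem_span_singleton] at h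
  obtain ⟨c, hc⟩ := h
  obtain ⟨c, rfl⟩ := hρ c
  obtain ⟨b, hb⟩ := hker (f ^ n - 1 - g * c) (by simp [hc])
  have hg0 : Ideal.Quotient.mk (Ideal.span {g}) g = 0 :=
    (Ideal.Quotient.eq_zero_iff_dvd _ _).2 dvd_rfl
  have hb' := congrArg (Ideal.Quotient.mk (Ideal.span {g})) hb
  set u := Ideal.Quotient.mk (Ideal.span {g}) f
  set N := Ideal.Quotient.mk (Ideal.span {g}) ((p : S) ^ (e - 1) * b) with hN
  have hu : u ^ n = 1 + N := by
    simp only [map_sub, map_mul, hg0, zero_mul, sub_zero, map_pow, map_one] at hb'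
    exact sub_eq_iff_eq_add'.1 hb'
  rw [orderOf_dvd_iff_pow_eq_one, mul_comm, pow_mul, hu, ← sub_eq_zero,
    ← mul_one ((1 + N) ^ p - 1)]
  obtain ⟨t, rfl⟩ : ∃ t, e = t + 2 := ⟨e - 2, by omega⟩
  simp only [show t + 2 - 1 = t + 1 from rfl] at hN
  apply one_add_pow_sub_one_mul_eq_zero
  · rw [mul_one, hN, ← map_natCast (Ideal.Quotient.mk (Ideal.span {g})), ← map_mul,
      show (p : S) * (p ^ (t + 1) * b) = p ^ (t + 2) * b by ring, hpS, zero_mul, map_zero]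
  · rw [mul_one, hN, ← map_mul,
      show (p : S) ^ (t + 1) * b * (p ^ (t + 1) * b) = p ^ (t + 2) * (p ^ t * b ^ 2) by ring,
      hpS, zero_mul, map_zero]

/-! ### Galois rings and their reductions -/

theorem cast_pow_eq_zero_galoisRing (h : ℤ[X]) (p e : ℕ) : ((p : GaloisRing h p e)) ^ e = 0 := by
  rw [← map_natCast (Ideal.Quotient.mk (Ideal.span {((p : BaseRing h) ^ e)})), ← map_pow,
    Ideal.Quotient.eq_zero_iff_dvd]

theorem finite_galoisRing {p : ℕ} (hp : p.Prime) {h : ℤ[X]} (hmonic : h.Monic) (e : ℕ) :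
    Finite (GaloisRing h p e) := by
  have : Module.Finite ℤ (BaseRing h) := hmonic.finite_adjoinRoot
  have : Module.Finite ℤ (GaloisRing h p e) := Module.Finite.of_surjective
    (Ideal.Quotient.mk (Ideal.span {((p : BaseRing h) ^ e)})).toIntAlgHom.toLinearMap
    Ideal.Quotient.mk_surjective
  refine Module.finite_of_fg_torsion _ fun x => ?_
  refine ⟨⟨(p : ℤ) ^ e, mem_nonZeroDivisors_of_ne_zero
    (by exact_mod_cast pow_ne_zero _ hp.ne_zero)⟩, ?_⟩
  rw [Submonoid.mk_smul, zsmul_eq_mul]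
  push_cast
  rw [cast_pow_eq_zero_galoisRing, zero_mul]

/-- The two quotients commute: `ℤ[t]` modulo `h` and then `p` is `𝔽_p[t]` modulo the reduction of
`h`. -/
theorem isField_residueRing {p : ℕ} (hp : p.Prime) {h : ℤ[X]}
    (hirr : Irreducible (h.map (Int.castRingHom (ZMod p)))) : IsField (GaloisRing h p 1) := by
  have : Fact p.Prime := ⟨hp⟩
  have : Fact (Irreducible (h.map (Int.castRingHom (ZMod p)))) := ⟨hirr⟩
  have hspan : Ideal.span {((p : BaseRing h) ^ 1)} =
      (Ideal.span {(p : ℤ)}).map (AdjoinRoot.of h) := by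
    rw [Ideal.map_span, Set.image_singleton, pow_one, map_natCast]
  let E₁ := (Ideal.quotEquivOfEq hspan).trans
    (AdjoinRoot.quotEquivQuotMap h (Ideal.span {(p : ℤ)})).toRingEquiv
  let E₂ := Ideal.quotientEquiv (Ideal.span {h.map (Ideal.Quotient.mk (Ideal.span {(p : ℤ)}))})
    (Ideal.span {h.map (Int.castRingHom (ZMod p))})
    (Polynomial.mapEquiv (Int.quotientSpanNatEquivZMod p)) (by
      rw [Ideal.map_span, Set.image_singleton]
      congr 2
      simp [Polynomial.map_map, Int.quotientSpanNatEquivZMod_comp_Quotient_mk])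
  exact MulEquiv.isField (Field.toIsField (AdjoinRoot (h.map (Int.castRingHom (ZMod p)))))
    (E₁.trans E₂).toMulEquiv

theorem reduction_surjective (h : ℤ[X]) (p : ℕ) {e' e : ℕ} (hle : e' ≤ e) :
    Function.Surjective (reduction h p hle) :=
  Ideal.Quotient.factor_surjective _

theorem reduction_comp_canonicalHom (h : ℤ[X]) (p : ℕ) {e' e : ℕ} (hle : e' ≤ e) :
    (reduction h p hle).comp (canonicalHom h p e) = canonicalHom h p e' := rfl

theorem reduction_comp_reduction (h : ℤ[X]) (p : ℕ) {e₁ e₂ e₃ : ℕ} (h₁₂ : e₁ ≤ e₂)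
    (h₂₃ : e₂ ≤ e₃) :
    (reduction h p h₁₂).comp (reduction h p h₂₃) = reduction h p (h₁₂.trans h₂₃) := by
  refine RingHom.ext fun x => ?_
  obtain ⟨x, rfl⟩ := Ideal.Quotient.mk_surjective x
  simp only [reduction, RingHom.comp_apply, Ideal.Quotient.factor_mk]

theorem dvd_of_reduction_eq_zero (h : ℤ[X]) (p : ℕ) {e' e : ℕ} (hle : e' ≤ e)
    {a : GaloisRing h p e} (ha : reduction h p hle a = 0) : (p : GaloisRing h p e) ^ e' ∣ a := by
  obtain ⟨a, rfl⟩ := Ideal.Quotient.mk_surjective a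
  have h1 : Ideal.Quotient.mk (Ideal.span {(p : BaseRing h) ^ e'}) a = 0 := ha
  rw [Ideal.Quotient.eq_zero_iff_dvd] at h1
  simpa using map_dvd (Ideal.Quotient.mk (Ideal.span {(p : BaseRing h) ^ e})) h1

theorem dvd_of_map_reduction_eq_zero (h : ℤ[X]) (p : ℕ) {e' e : ℕ} (hle : e' ≤ e)
    {a : (GaloisRing h p e)[X]} (ha : a.map (reduction h p hle) = 0) :
    (p : (GaloisRing h p e)[X]) ^ e' ∣ a := by
  rw [← map_natCast (C : GaloisRing h p e →+* _), ← C_pow, C_dvd_iff_dvd_coeff]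
  intro i
  exact dvd_of_reduction_eq_zero h p hle (by rw [← coeff_map, ha, coeff_zero])

theorem isNilpotent_or_isUnit_galoisRing_quotient {p : ℕ} (hp : p.Prime) {h : ℤ[X]}
    (hirr : Irreducible (h.map (Int.castRingHom (ZMod p)))) {e : ℕ} (he : 1 ≤ e)
    {g : (GaloisRing h p e)[X]} {G : (GaloisRing h p 1)[X]} {k : ℕ} (hG : Irreducible G)
    (hg : g.map (reduction h p he) = G ^ k) (a : (GaloisRing h p e)[X] ⧸ Ideal.span {g}) :
    IsNilpotent a ∨ IsUnit a := by
  let _ := (isField_residueRing hp hirr).toField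
  refine isNilpotent_or_isUnit_mk_of_map_eq_pow (reduction h p he) (reduction_surjective h p he)
    (fun b hb => ?_) hG hg a
  obtain ⟨c, rfl⟩ := dvd_of_reduction_eq_zero h p he hb
  exact ⟨e, by rw [mul_pow, pow_one, cast_pow_eq_zero_galoisRing, zero_mul]⟩

theorem finite_galoisRing_quotient {p : ℕ} (hp : p.Prime) {h : ℤ[X]} (hmonic : h.Monic) (e : ℕ)
    {m : (GaloisRing h p e)[X]} (hm : m.Monic) :
    Finite ((GaloisRing h p e)[X] ⧸ Ideal.span {m}) := by
  have := finite_galoisRing hp hmonic e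
  have := hm.finite_quotient
  exact Module.finite_of_finite (GaloisRing h p e)

theorem IsFDecomposition.map {S T : Type*} [CommRing S] [CommRing T] {f m m₁ m₂ : S}
    (hd : IsFDecomposition f m m₁ m₂) (ρ : S →+* T) :
    IsFDecomposition (ρ f) (ρ m) (ρ m₁) (ρ m₂) where
  eq_mul := by rw [hd.eq_mul, map_mul]
  coprime := hd.coprime.map ρ
  mem_radical := by
    obtain ⟨n, hn⟩ := hd.mem_radical
    rw [Ideal.mem_span_singleton] at hn
    exact ⟨n, Ideal.mem_span_singleton.2 (by rw [← map_pow]; exact map_dvd ρ hn)⟩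

/-! ### Assembly: comparing levels `e` and `e - 1` -/

theorem mainTheorem3
    (p : ℕ) (hp : p.Prime) (h : ℤ[X]) (hmonic : h.Monic)
    (hirr : Irreducible (h.map (Int.castRingHom (ZMod p))))
    (f m : (BaseRing h)[X]) (hm : m.Monic)
    (hf : 1 ≤ f.natDegree) (hfm : f.natDegree < m.natDegree)
    (e : ℕ) (he : 1 < e)
    (m₁ m₂ : (GaloisRing h p e)[X])
    (hdec : IsFDecomposition (f.map (canonicalHom h p e)) (m.map (canonicalHom h p e)) m₁ m₂)
    (r : ℕ) (g : Fin r → (GaloisRing h p e)[X])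
    (hprod : m₁ = ∏ i, g i)
    (hcop : Pairwise fun i j => IsCoprime (g i) (g j))
    (G : Fin r → (GaloisRing h p 1)[X]) (k : Fin r → ℕ)
    (hG : ∀ i, Irreducible (G i))
    (hgG : ∀ i, (g i).map (reduction h p he.le) = G i ^ k i) :
    cycleLengths (galoisSystem h p e f m) =
      cycleLengths (galoisSystem h p (e - 1) f m) ∪
        bigLcmProduct fun i => {1, polyOrder (f.map (canonicalHom h p e)) (g i)} := by
  have hle : e - 1 ≤ e := Nat.sub_le e 1
  have he' : 1 ≤ e - 1 := by omega
  set ρ := mapRingHom (reduction h p hle) with hρ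
  have hρs : Function.Surjective ρ := Polynomial.map_surjective _ (reduction_surjective h p hle)
  have hmap : ∀ q : (BaseRing h)[X],
      ρ (q.map (canonicalHom h p e)) = q.map (canonicalHom h p (e - 1)) := fun q => by
    rw [hρ, coe_mapRingHom, Polynomial.map_map, reduction_comp_canonicalHom]
  have hfin := finite_galoisRing_quotient hp hmonic e (hm.map (canonicalHom h p e))
  have hfin' := finite_galoisRing_quotient hp hmonic (e - 1) (hm.map (canonicalHom h p (e - 1)))
  have hdec' := hdec.map ρ
  rw [hmap, hmap] at hdec'
  have hprod' : ρ m₁ = ∏ i, ρ (g i) := by rw [hprod, map_prod]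
  have hcop' : Pairwise fun i j => IsCoprime (ρ (g i)) (ρ (g j)) :=
    fun i j hij => (hcop hij).map ρ
  have hnilS : ∀ n, (p : (GaloisRing h p n)[X]) ^ n = 0 := fun n => by
    rw [← map_natCast (C : GaloisRing h p n →+* _), ← C_pow, cast_pow_eq_zero_galoisRing, C_0]
  have hnil : ∀ (n : ℕ) (q : (GaloisRing h p n)[X]),
      IsNilpotent ((p : ℕ) : (GaloisRing h p n)[X] ⧸ Ideal.span {q}) := fun n q => by
    rw [← map_natCast (Ideal.Quotient.mk (Ideal.span {q}))]
    have hpn : IsNilpotent (p : (GaloisRing h p n)[X]) := ⟨n, hnilS n⟩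
    exact hpn.map (Ideal.Quotient.mk (Ideal.span {q}))
  have hgm : ∀ i, g i ∣ m₁ := fun i => hprod ▸ Finset.dvd_prod_of_mem g (Finset.mem_univ i)
  have hgm' : ∀ i, ρ (g i) ∣ ρ m₁ := fun i => map_dvd ρ (hgm i)
  choose d J hd hord hper using fun i => range_minimalPeriod_mul hp (hnil e (g i))
    (isNilpotent_or_isUnit_galoisRing_quotient hp hirr he.le (hG i) (hgG i))
    (isOfFinOrder_mk_of_dvd ((hgm i).trans (hdec.eq_mul ▸ dvd_mul_right _ _))
      (hdec.coprime.of_isCoprime_of_dvd_right (hgm i)))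
  choose d' J' hd' hord' hper' using fun i => range_minimalPeriod_mul hp (hnil (e - 1) (ρ (g i)))
    (isNilpotent_or_isUnit_galoisRing_quotient hp hirr he' (hG i) (k := k i) (by
      rw [hρ, coe_mapRingHom, Polynomial.map_map, reduction_comp_reduction, hgG]))
    (isOfFinOrder_mk_of_dvd ((hgm' i).trans (hdec'.eq_mul ▸ dvd_mul_right _ _))
      (hdec'.coprime.of_isCoprime_of_dvd_right (hgm' i)))
  have hJ : ∀ i, d' i = d i ∧ J' i ≤ J i ∧ J i ≤ J' i + 1 := fun i => by
    apply coprime_mul_pow_sandwich hp (hd i) (hd' i)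
    · rw [← hord, ← hord', ← hmap]
      exact orderOf_mk_map_dvd ρ _ _
    · rw [← hord, ← hord', ← hmap]
      exact orderOf_mk_dvd_mul hρs he (hnilS e)
        (fun a ha => dvd_of_map_reduction_eq_zero h p hle ha) _ _
  obtain rfl : d' = d := funext fun i => (hJ i).1
  ext n
  rw [Set.mem_union, mem_bigLcmProduct, galoisSystem, galoisSystem,
    cycleLengths_mulMap hdec hprod hcop, cycleLengths_mulMap hdec' hprod' hcop']
  simp only [hper, hper', Set.mem_insert_iff, Set.mem_singleton_iff, polyOrder_eq_orderOf, hord]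
  exact exists_lcm_mul_pow_iff hd (fun i => (hJ i).2.1) (fun i => (hJ i).2.2) n
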